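/- Let $E$ be a Euclidean space with inner product $\langle\cdot,\cdot\rangle$, let $Y\subset E$ be nonempty, convex and compact, let $\|\cdot\|$ be a norm on $E$ with conjugate norm $\|\xi\|_*=\max_{\|x\|\le1}\langle\xi,x\rangle$, and let $\omega:Y\to\mathbb R$ be continuous and convex, with a selection $\omega'(y)\in\partial\omega(y)$ that is continuous on $Y^o=\{y\in Y:\partial\omega(y)\ne\emptyset\}$ and satisfies $\langle\omega'(y)-\omega'(z),y-z\rangle\ge\|y-z\|^2$ for $y,z\in Y^o$. Put $\Omega=\sqrt{2[\max_Y\omega-\min_Y\omega]}$ and $y_\omega=\operatorname{argmin}_Y\omega$. Let $g:Y\to E$ be a vector field with $\|g(y)\|_*\le L[g]<\infty$ for all $y\in Y$. For $y\in Y$ put $h_y(z)=\langle g(y),y-z\rangle$; for search points $y_1,\dots,y_t$ let $\mathcal F_t$ be the set of the convex combinations $\sum_{\tau\le t}\lambda_\tau h_{y_\tau}$, each given by its weights $\lambda_\tau\ge0$, $\sum_\tau\lambda_\tau=1$. The Non-Euclidean Restricted Memory Level method with memory $m\ge1$, level parameter $\gamma\in(0,1)$, phase parameter $\theta\in(0,1)$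 and target $\varepsilon>0$ works as follows. Initialization (step 1): $y_1=y_\omega$, compute $g(y_1)$ and $f_1=\max_Yh_{y_1}$. If $f_1=0$, terminate with output $h_{y_1}$; otherwise begin phase 1. Beginning of phase $s$, with $t$ search points built so far and with $f_s>0$: put $\ell_s=\gamma f_s$, choose any $m$ functions in $\mathcal F_t$, forming the memory $h_1,\dots,h_m$, such that the closure of $\{y\in Y:h_j(y)>\ell_s,\ 1\le j\le m\}$ is nonempty, and let $u=y_\omega$ be the current search point. A step of phase $s$, with $t$ search points built so far, memory $h_1,\dots,h_m$ and current search point $u$: put $y_{t+1}=u$, compute $g(u)$, put $h_{m+1}=h_u$, and solve $\mathrm{Opt}=\max_{y\in Y}\min_{1\le j\le m+1}h_j(y)$, getting weights $\lambda_j\ge0$, $\sum_j\lambda_j=1$, such that $h=\sum_j\lambda_jh_j$ satisfies $\max_Yh=\mathrm{Opt}$. (A) If $\mathrm{Opt}\le\varepsilon$, terminate with output $h\in\mathcal F_{t+1}$. (B) Otherwise, if $\mathrm{Opt}<\ell_s+\theta(f_s-\ell_s)$, begin phase $s+1$ with $f_{s+1}=\mathrm{Opt}$. (C) Otherwise let $u^+$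 be the minimizer of $\omega$ over $\{y\in Y:h_j(y)\ge\ell_s,\ 1\le j\le m+1\}$, with Lagrange multipliers $\mu_j\ge0$ such that $\mu_j[h_j(u^+)-\ell_s]=0$ for all $j$ and $\langle\omega'(u^+)-\sum_j\mu_j\nabla h_j,\,y-u^+\rangle\ge0$ for all $y\in Y$. If $\mu=\sum_j\mu_j>0$, the new memory consists of $\mu^{-1}\sum_j\mu_jh_j$ and of any $m-1$ of the functions $h_1,\dots,h_{m+1}$; if $\mu=0$, it consists of any $m$ of them. Go on with phase $s$, with the search point $u^+$. Claim. For every $\varepsilon>0$ and whatever choices are made, every step of the method can be carried out, and the method terminates after finitely many steps $t$, with an execution protocol $\{y_\tau,g(y_\tau)\}_{\tau=1}^t$, $y_\tau\in Y$, and an accuracy certificate $\lambda_1,\dots,\lambda_t\ge0$, $\sum_\tau\lambda_\tau=1$ (the weights of the output function), of resolution $$\max_{y\in Y}\sum_{\tau=1}^t\lambda_\tau\langle g(y_\tau),y_\tau-y\rangle\le\varepsilon .$$ Counting the initialization as a step, so that the number of steps $t$ is the number of evaluations of $g$, if $\varepsilon\le\Omega L[g]$ then $$t\le C(\gamma,\theta)\,\frac{\Omega^2L^2[g]}{\varepsilon^2},\qquad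 C(\gamma,\theta)=\frac{1+\gamma^2}{\gamma^2\bigl[1-(\gamma+(1-\gamma)\theta)^2\bigr]},$$ and if $\varepsilon>\Omega L[g]$ then $t\le2$. -/

import Mathlib

namespace NERML

noncomputable section

/-- The norm conjugate to `nrm` with respect to the inner product:
`‖ξ‖_* = sup {⟪ξ, x⟫ : ‖x‖ ≤ 1}`. -/
def dualNorm {E : Type*} [NormedAddCommGroup E] [InnerProductSpace ℝ E]
    (nrm : Seminorm ℝ E) (ξ : E) : ℝ :=
  sSup {r : ℝ | ∃ x : E, nrm x ≤ 1 ∧ r = inner ℝ ξ x}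

/-- The subdifferential at `y` of a function given on `Y`. -/
def subdiff {E : Type*} [NormedAddCommGroup E] [InnerProductSpace ℝ E]
    (Y : Set E) (ω : E → ℝ) (y : E) : Set E :=
  {p : E | ∀ z ∈ Y, ω y + inner ℝ p (z - y) ≤ ω z}

/-- `Y^o`, the set of the points of `Y` at which the subdifferential is nonempty. -/
def subdiffDomain {E : Type*} [NormedAddCommGroup E] [InnerProductSpace ℝ E]
    (Y : Set E) (ω : E → ℝ) : Set E :=
  {y : E | y ∈ Y ∧ (subdiff Y ω y).Nonempty}

/-- A convex compact nonempty set `Y` in a Euclidean space with a proximal setup: a norm `nrm`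
(in general not the Euclidean one) and a distance-generating function `ω` on `Y`, with a continuous
selection `ω'` of its subdifferentials; only the values of `ω` on `Y` and of `ω'` on `Y^o`
matter. -/
structure ProximalSetup (E : Type*) [NormedAddCommGroup E] [InnerProductSpace ℝ E] where
  Y : Set E
  nonempty_Y : Y.Nonempty
  convex_Y : Convex ℝ Y
  isCompact_Y : IsCompact Y
  nrm : Seminorm ℝ E
  nrm_definite : ∀ x : E, nrm x = 0 → x = 0
  ω : E → ℝ
  continuousOn_ω : ContinuousOn ω Y
  convexOn_ω : ConvexOn ℝ Y ω
  ω' : E → E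
  ω'_mem : ∀ y ∈ subdiffDomain Y ω, ω' y ∈ subdiff Y ω y
  continuousOn_ω' : ContinuousOn ω' (subdiffDomain Y ω)
  strongly_convex : ∀ y ∈ subdiffDomain Y ω, ∀ z ∈ subdiffDomain Y ω,
    nrm (y - z) ^ 2 ≤ inner ℝ (ω' y - ω' z) (y - z)

/-- The `ω`-diameter `Ω[Y, ω]`. -/
def ProximalSetup.diam {E : Type*} [NormedAddCommGroup E] [InnerProductSpace ℝ E]
    (S : ProximalSetup E) : ℝ :=
  Real.sqrt (2 * (sSup (S.ω '' S.Y) - sInf (S.ω '' S.Y)))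

/-- `y ∈ Argmin_U ω`. -/
def ProximalSetup.IsArgmin {E : Type*} [NormedAddCommGroup E] [InnerProductSpace ℝ E]
    (S : ProximalSetup E) (U : Set E) (y : E) : Prop :=
  y ∈ U ∧ ∀ z ∈ U, S.ω y ≤ S.ω z

/-- An execution protocol of length `t`: the pairs (search point, value of the vector field). -/
abbrev Protocol (E : Type*) (t : ℕ) := Fin t → E × E

/-- The affine function `z ↦ ∑ i, w i ⟪g i, y i - z⟫` with weights `w` over the protocol
`P i = (y i, g i)`. The family `F_S` is represented by the weights in the standard simplex. -/
def affVal {E : Type*} [NormedAddCommGroup E] [InnerProductSpace ℝ E] {t : ℕ}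
    (P : Protocol E t) (w : Fin t → ℝ) (z : E) : ℝ :=
  ∑ i, w i * inner ℝ (P i).2 ((P i).1 - z)

/-- The (constant) gradient of the affine function `affVal P w`. -/
def affGrad {E : Type*} [NormedAddCommGroup E] [InnerProductSpace ℝ E] {t : ℕ}
    (P : Protocol E t) (w : Fin t → ℝ) : E :=
  -∑ i, w i • (P i).2

/-- `max_{z ∈ Y} ∑ i, w i ⟪g i, y i - z⟫`: the resolution of the certificate `w` at the
protocol `P`. -/
def resolution {E : Type*} [NormedAddCommGroup E] [InnerProductSpace ℝ E] {t : ℕ}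
    (Y : Set E) (P : Protocol E t) (w : Fin t → ℝ) : ℝ :=
  sSup (affVal P w '' Y)

/-- `max_{z ∈ Y} min_j h_j(z)` for the affine functions `h_j = affVal P (H j)`. -/
def optVal {E : Type*} [NormedAddCommGroup E] [InnerProductSpace ℝ E] {t k : ℕ}
    (Y : Set E) (P : Protocol E t) (H : Fin k → Fin t → ℝ) : ℝ :=
  sSup ((fun z => ⨅ j, affVal P (H j) z) '' Y)

/-- `∑ j, c j h_j`, in terms of the weights of the `h_j`. -/
def comb {t k : ℕ} (c : Fin k → ℝ) (H : Fin k → Fin t → ℝ) : Fin t → ℝ :=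
  fun i => ∑ j, c j * H j i

/-- What the method stores at the beginning of a step of a phase, after `t` calls to the
oracle. -/
structure State (E : Type*) (m t : ℕ) where
  /-- all search points so far, with the values of the vector field -/
  P : Protocol E t
  /-- the number `f_s` of the current phase -/
  f : ℝ
  /-- the weights of the `m` affine functions kept in the memory -/
  mem : Fin m → Fin t → ℝ
  /-- the current search point, at which the oracle will be called -/
  u : E

/-- The protocol extended by the current search point. -/
def State.newP {E : Type*} {m t : ℕ} (σ : State E m t) (g : E → E) : Protocol E (t + 1) :=
  Fin.snoc (α := fun _ => E × E) σ.P (σ.u, g σ.u)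

/-- The `m + 1` functions of the step, as weights over the extended protocol: the `m` functions in
the memory, and last the function `z ↦ ⟪g u, u - z⟫`. -/
def State.bundle {E : Type*} {m t : ℕ} (σ : State E m t) : Fin (m + 1) → Fin (t + 1) → ℝ :=
  Fin.snoc (α := fun _ => Fin (t + 1) → ℝ)
    (fun j => Fin.snoc (α := fun _ => ℝ) (σ.mem j) 0) (Pi.single (Fin.last t) 1)

/-- The auxiliary problem `max_{z ∈ Y} min_{1 ≤ j ≤ m + 1} h_j(z)` of the step. -/
def State.opt {E : Type*} [NormedAddCommGroup E] [InnerProductSpace ℝ E] {m t : ℕ}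
    (S : ProximalSetup E) (g : E → E) (σ : State E m t) : ℝ :=
  optVal S.Y (σ.newP g) σ.bundle

/-- `σ` begins a phase with protocol `P` and `f_s = f`: its memory consists of any `m` elements of
`F_S` for which the closure of `{y ∈ Y : h_j(y) > γ f for all j}` is nonempty, and its search point
is the `ω`-center of `Y`. -/
def BeginsPhase {E : Type*} [NormedAddCommGroup E] [InnerProductSpace ℝ E] {m t : ℕ}
    (S : ProximalSetup E) (γ : ℝ) (P : Protocol E t) (f : ℝ) (σ : State E m t) : Prop :=
  σ.P = P ∧ σ.f = f ∧
  (∀ j, σ.mem j ∈ stdSimplex ℝ (Fin t)) ∧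
  (closure {y : E | y ∈ S.Y ∧ ∀ j, γ * f < affVal P (σ.mem j) y}).Nonempty ∧
  S.IsArgmin S.Y σ.u

/-- `lam` are the weights obtained with the auxiliary problem of the step: the convex combination
of the `m + 1` functions with the weights `lam` has the maximum `Opt` over `Y`. -/
def SolvesAux {E : Type*} [NormedAddCommGroup E] [InnerProductSpace ℝ E] {m t : ℕ}
    (S : ProximalSetup E) (g : E → E) (σ : State E m t) (lam : Fin (m + 1) → ℝ) : Prop :=
  lam ∈ stdSimplex ℝ (Fin (m + 1)) ∧
  resolution S.Y (σ.newP g) (comb lam σ.bundle) = σ.opt S g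

/-- `σ'` follows `σ` in the same phase: the new search point minimizes `ω` over
`{y ∈ Y : h_j(y) ≥ ℓ, 1 ≤ j ≤ m + 1}`, `ℓ = γ f_s`, and `μ` are Lagrange multipliers of this
problem. If `∑ μ_j > 0`, the new memory consists of the aggregate `(∑ μ_j)⁻¹ ∑ μ_j h_j` (first) and
of `m - 1` of the old functions, any two being discarded (`e 0` and the one outside the range of
`e`); if `∑ μ_j = 0`, of `m` of the old functions, any one being discarded. -/
def ContinuesPhase {E : Type*} [NormedAddCommGroup E] [InnerProductSpace ℝ E] {m t : ℕ}
    (S : ProximalSetup E) (g : E → E) (γ : ℝ) (σ : State E m t) (σ' : State E m (t + 1)) : Prop :=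
  σ'.P = σ.newP g ∧ σ'.f = σ.f ∧
  S.IsArgmin {y : E | y ∈ S.Y ∧ ∀ j, γ * σ.f ≤ affVal (σ.newP g) (σ.bundle j) y} σ'.u ∧
  ∃ (μ : Fin (m + 1) → ℝ) (e : Fin m ↪ Fin (m + 1)),
    (∀ j, 0 ≤ μ j) ∧
    (∀ j, μ j * (affVal (σ.newP g) (σ.bundle j) σ'.u - γ * σ.f) = 0) ∧
    (∀ y ∈ S.Y,
      0 ≤ inner ℝ (S.ω' σ'.u - ∑ j, μ j • affGrad (σ.newP g) (σ.bundle j)) (y - σ'.u)) ∧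
    (0 < ∑ j, μ j → ∀ j : Fin m,
      σ'.mem j = if j.val = 0 then comb (fun i => (∑ k, μ k)⁻¹ * μ i) σ.bundle
        else σ.bundle (e j)) ∧
    (∑ j, μ j = 0 → ∀ j : Fin m, σ'.mem j = σ.bundle (e j))

/-- The configurations of the method: before the start, in the course of the run, and after
termination, with the output (execution protocol and weights). -/
inductive Config (E : Type*) (m : ℕ) where
  | start : Config E m
  | running (t : ℕ) (σ : State E m t) : Config E m
  | done (t : ℕ) (P : Protocol E t) (lam : Fin t → ℝ) : Config E m

/-- One step of the method, with one call to the oracle `g`. All choices that the method leaves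
open are left open here. -/
inductive Step {E : Type*} [NormedAddCommGroup E] [InnerProductSpace ℝ E] {m : ℕ}
    (S : ProximalSetup E) (g : E → E) (γ θ ε : ℝ) : Config E m → Config E m → Prop
  /-- initialization, `f_1 = 0` -/
  | initStop (y : E) (hy : S.IsArgmin S.Y y)
      (hf : resolution S.Y (fun _ : Fin 1 => (y, g y)) (fun _ => 1) = 0) :
      Step S g γ θ ε Config.start (Config.done 1 (fun _ => (y, g y)) (fun _ => 1))
  /-- initialization, `f_1 > 0`: the first phase begins -/
  | initPhase (y : E) (hy : S.IsArgmin S.Y y)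
      (hf : 0 < resolution S.Y (fun _ : Fin 1 => (y, g y)) (fun _ => 1))
      (σ : State E m 1)
      (hσ : BeginsPhase S γ (fun _ => (y, g y))
        (resolution S.Y (fun _ : Fin 1 => (y, g y)) (fun _ => 1)) σ) :
      Step S g γ θ ε Config.start (Config.running 1 σ)
  /-- case A: termination -/
  | terminate (t : ℕ) (σ : State E m t) (hA : σ.opt S g ≤ ε)
      (lam : Fin (m + 1) → ℝ) (hlam : SolvesAux S g σ lam) :
      Step S g γ θ ε (Config.running t σ)
        (Config.done (t + 1) (σ.newP g) (comb lam σ.bundle))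
  /-- case B: the next phase begins, with `f_{s+1} = max_Y h^{s+1} = Opt`, where
  `h^{s+1} = ∑ j, lam j h_j` -/
  | newPhase (t : ℕ) (σ : State E m t) (hA : ε < σ.opt S g)
      (hB : σ.opt S g < γ * σ.f + θ * (σ.f - γ * σ.f))
      (lam : Fin (m + 1) → ℝ) (hlam : SolvesAux S g σ lam)
      (σ' : State E m (t + 1))
      (hσ' : BeginsPhase S γ (σ.newP g)
        (resolution S.Y (σ.newP g) (comb lam σ.bundle)) σ') :
      Step S g γ θ ε (Config.running t σ) (Config.running (t + 1) σ')
  /-- case C: the phase goes on -/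
  | samePhase (t : ℕ) (σ : State E m t) (hA : ε < σ.opt S g)
      (hC : γ * σ.f + θ * (σ.f - γ * σ.f) ≤ σ.opt S g)
      (σ' : State E m (t + 1)) (hσ' : ContinuesPhase S g γ σ σ') :
      Step S g γ θ ε (Config.running t σ) (Config.running (t + 1) σ')

/-- The configurations that the method can reach in exactly `T` steps. -/
inductive ReachedIn {E : Type*} [NormedAddCommGroup E] [InnerProductSpace ℝ E] {m : ℕ}
    (S : ProximalSetup E) (g : E → E) (γ θ ε : ℝ) : ℕ → Config E m → Prop
  | zero : ReachedIn S g γ θ ε 0 Config.start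
  | succ (T : ℕ) (c c' : Config E m) (hc : ReachedIn S g γ θ ε T c)
      (hstep : Step S g γ θ ε c c') : ReachedIn S g γ θ ε (T + 1) c'

/-- `C(γ, θ)`. -/
def complexityConst (γ θ : ℝ) : ℝ :=
  (1 + γ ^ 2) / (γ ^ 2 * (1 - (γ + (1 - γ) * θ) ^ 2))

end

end NERML

/-!
Strong monotonicity of the selection `ω'` makes `ω` grow quadratically away from each of its
subgradients. Within a phase, the current search point `u` minimizes `ω` over the points of `Y` that
satisfy the constraints `h_j ≥ γ f` of the memory; the aggregate `μ⁻¹ ∑ μ_j h_j` alone already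
guarantees this, which is why two of the functions may be forgotten. The next search point `u⁺`
satisfies these constraints and also `γ f ≤ ⟨g u, u - u⁺⟩ ≤ L ‖u - u⁺‖`, so
`ω u⁺ - ω u ≥ ‖u⁺ - u‖² / 2 ≥ (γ f / L)² / 2`, and as `ω` varies by at most `Ω² / 2` on `Y`, a
phase with value `f` has at most `(Ω L / (γ f))² + 1` steps. The values `f` decrease by the factor
`q = γ + (1 - γ) θ` at least from one phase to the next, so the sum over the phases is dominated by
a geometric series with ratio `q²`. The multipliers exist because in case C the level `γ f` is
strictly below the optimal value of the auxiliary problem, which is Slater's condition.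
-/

namespace NERML

open Filter Set Topology

section Separation

variable {ι : Type*} [Fintype ι]

theorem nonneg_of_forall_neg_mul_le {a b : ℝ} (h : ∀ s, 0 ≤ s → -(s * a) ≤ b) : 0 ≤ a := by
  by_contra! ha
  have hb : 0 ≤ b := by simpa only [zero_mul, neg_zero] using h 0 le_rfl
  have hle := h ((b + 1) / -a) (div_nonneg (by linarith) (by linarith))
  rw [← mul_neg, div_mul_cancel₀ _ (neg_ne_zero.2 ha.ne)] at hle
  linarith

theorem exists_mem_stdSimplex_sum_mul_nonneg {C : Set (ι → ℝ)} (hC : Convex ℝ C)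
    (hne : C.Nonempty) (h : ∀ v ∈ C, ∃ j, 0 ≤ v j) :
    ∃ lam ∈ stdSimplex ℝ ι, ∀ v ∈ C, 0 ≤ ∑ j, lam j * v j := by
  classical
  set N : Set (ι → ℝ) := univ.pi fun _ => Iio 0 with hN
  have hdisj : Disjoint N C := disjoint_left.2 fun v hvN hvC =>
    let ⟨j, hj⟩ := h v hvC
    hj.not_gt (hvN j (mem_univ j))
  obtain ⟨F, b, hFN, hFC⟩ := geometric_hahn_banach_open
    (convex_pi fun _ _ => convex_Iio 0) (isOpen_set_pi finite_univ fun _ _ => isOpen_Iio) hC hdisj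
  have hF_le : ∀ v : ι → ℝ, (∀ j, v j ≤ 0) → F v ≤ b := fun v hv => by
    refine closure_minimal (fun w hw => (hFN w hw).le) (isClosed_le F.continuous continuous_const)
      (?_ : v ∈ closure N)
    simpa only [hN, closure_pi_set, closure_Iio, mem_univ_pi, mem_Iic] using hv
  set c : ι → ℝ := fun j => F (Pi.single j 1)
  have hF_eq : ∀ v, F v = ∑ j, c j * v j := fun v => by
    conv_lhs => rw [pi_eq_sum_univ' v]
    simp only [map_sum, map_smul, smul_eq_mul, mul_comm, c]
  have hb : 0 ≤ b := by simpa only [map_zero] using hF_le 0 fun _ => le_rfl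
  have hc : ∀ j, 0 ≤ c j := fun j => nonneg_of_forall_neg_mul_le fun s hs => by
    rw [← smul_eq_mul, ← map_smul, ← map_neg]
    refine hF_le _ fun i => neg_nonpos.2 (mul_nonneg hs ?_)
    rw [Pi.single_apply]
    split_ifs <;> norm_num
  have hsum : 0 < ∑ j, c j := by
    have hlt := hFN (fun _ => -1) fun _ _ => mem_Iio.2 neg_one_lt_zero
    obtain ⟨v, hv⟩ := hne
    refine (Finset.sum_nonneg fun j _ => hc j).lt_of_ne' fun hzero => ?_
    have hc_zero := (Finset.sum_eq_zero_iff_of_nonneg fun j _ => hc j).1 hzero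
    have hF_zero : ∀ v, F v = 0 := fun v =>
      (hF_eq v).trans (Finset.sum_eq_zero fun j hj => by rw [hc_zero j hj, zero_mul])
    exact (hlt.trans_le (hFC v hv)).ne ((hF_zero _).trans (hF_zero v).symm)
  refine ⟨fun j => (∑ i, c i)⁻¹ * c j, ⟨fun j => mul_nonneg (inv_nonneg.2 hsum.le) (hc j), ?_⟩,
    fun v hv => ?_⟩
  · rw [← Finset.mul_sum, inv_mul_cancel₀ hsum.ne']
  · simp only [mul_assoc, ← Finset.mul_sum, ← hF_eq]
    exact mul_nonneg (inv_nonneg.2 hsum.le) (hb.trans (hFC v hv))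

variable {E : Type*} [AddCommGroup E] [Module ℝ E] {Y : Set E}

theorem exists_mem_stdSimplex_sum_mul_convexOn_nonneg (hY : Y.Nonempty) {φ : ι → E → ℝ}
    (hφ : ∀ j, ConvexOn ℝ Y (φ j)) (h : ∀ y ∈ Y, ∃ j, 0 ≤ φ j y) :
    ∃ lam ∈ stdSimplex ℝ ι, ∀ y ∈ Y, 0 ≤ ∑ j, lam j * φ j y := by
  obtain ⟨y₀, hy₀⟩ := hY
  have hYc : Convex ℝ Y := (hφ (h y₀ hy₀).choose).1
  have hconv : Convex ℝ {v : ι → ℝ | ∃ y ∈ Y, ∀ j, φ j y ≤ v j} := by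
    rintro v ⟨y, hy, hv⟩ w ⟨z, hz, hw⟩ a b ha hb hab
    refine ⟨a • y + b • z, hYc hy hz ha hb hab, fun j => ?_⟩
    calc φ j (a • y + b • z) ≤ a • φ j y + b • φ j z := (hφ j).2 hy hz ha hb hab
      _ ≤ a • v j + b • w j := by gcongr; exacts [hv j, hw j]
  obtain ⟨lam, hlam, hnonneg⟩ := exists_mem_stdSimplex_sum_mul_nonneg hconv
    ⟨fun j => φ j y₀, y₀, hy₀, fun _ => le_rfl⟩
    fun v ⟨y, hy, hv⟩ => (h y hy).imp fun j hj => hj.trans (hv j)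
  exact ⟨lam, hlam, fun y hy => hnonneg (fun j => φ j y) ⟨y, hy, fun _ => le_rfl⟩⟩

theorem exists_lagrange_multipliers {ω : E → ℝ} (hω : ConvexOn ℝ Y ω) {φ : ι → E → ℝ}
    (hφ : ∀ j, ConvexOn ℝ Y (φ j)) {u : E} (hu : u ∈ Y) (hfeas : ∀ j, φ j u ≤ 0)
    (hmin : ∀ y ∈ Y, (∀ j, φ j y ≤ 0) → ω u ≤ ω y) (hslater : ∃ z ∈ Y, ∀ j, φ j z < 0) :
    ∃ μ : ι → ℝ, (∀ j, 0 ≤ μ j) ∧ (∀ j, μ j * φ j u = 0) ∧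
      ∀ y ∈ Y, ω u ≤ ω y + ∑ j, μ j * φ j y := by
  obtain ⟨lam, ⟨hlam_nonneg, hlam_sum⟩, hlam⟩ := exists_mem_stdSimplex_sum_mul_convexOn_nonneg
    ⟨u, hu⟩ (φ := fun o : Option ι => o.elim (fun y => ω y - ω u) φ)
    (fun o => o.casesOn (hω.sub (concaveOn_const _ hω.1)) hφ) fun y hy => by
      by_cases hfy : ∀ j, φ j y ≤ 0
      · exact ⟨none, sub_nonneg.2 (hmin y hy hfy)⟩
      · push Not at hfy
        exact hfy.imp' some fun _ => le_of_lt
  simp only [Fintype.sum_option, Option.elim] at hlam hlam_sum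
  have hterm : ∀ y, (∀ j, φ j y ≤ 0) → ∀ j ∈ Finset.univ, lam (some j) * φ j y ≤ 0 :=
    fun y hy j _ => mul_nonpos_of_nonneg_of_nonpos (hlam_nonneg _) (hy j)
  have hpos : 0 < lam none := by
    refine (hlam_nonneg none).lt_of_ne' fun hzero => ?_
    obtain ⟨z, hz, hφz⟩ := hslater
    have hle := hterm z fun j => (hφz j).le
    have hge := hlam z hz
    rw [hzero, zero_mul, zero_add] at hge
    have hall := (Finset.sum_eq_zero_iff_of_nonpos hle).1 (le_antisymm (Finset.sum_nonpos hle) hge)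
    have hsome : ∀ j, lam (some j) = 0 := fun j =>
      (mul_eq_zero.1 (hall j (Finset.mem_univ j))).resolve_right (hφz j).ne
    simp only [hzero, hsome, Finset.sum_const_zero, add_zero, zero_ne_one] at hlam_sum
  refine ⟨fun j => (lam none)⁻¹ * lam (some j),
    fun j => mul_nonneg (inv_nonneg.2 hpos.le) (hlam_nonneg _), fun j => ?_, fun y hy => ?_⟩
  · have hle := hterm u hfeas
    have hge := hlam u hu
    rw [sub_self, mul_zero, zero_add] at hge
    have hall := (Finset.sum_eq_zero_iff_of_nonpos hle).1 (le_antisymm (Finset.sum_nonpos hle) hge)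
    rw [mul_assoc, hall j (Finset.mem_univ j), mul_zero]
  · have hge := mul_nonneg (inv_nonneg.2 hpos.le) (hlam y hy)
    rw [mul_add, inv_mul_cancel_left₀ hpos.ne'] at hge
    simp only [mul_assoc, ← Finset.mul_sum]
    linarith

end Separation

section DualNorm

theorem continuous_seminorm_of_finiteDimensional {E : Type*} [NormedAddCommGroup E]
    [NormedSpace ℝ E] [FiniteDimensional ℝ E] (p : Seminorm ℝ E) : Continuous p :=
  p.convexOn.locallyLipschitz.continuous

theorem exists_norm_le_mul_seminorm {E : Type*} [NormedAddCommGroup E] [NormedSpace ℝ E]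
    [FiniteDimensional ℝ E] {p : Seminorm ℝ E} (hp : ∀ x, p x = 0 → x = 0) :
    ∃ K : ℝ, ∀ x, ‖x‖ ≤ K * p x := by
  rcases subsingleton_or_nontrivial E with hE | hE
  · exact ⟨0, fun x => by simp [Subsingleton.elim x 0]⟩
  obtain ⟨x₀, hx₀, hmin⟩ := (isCompact_sphere (0 : E) 1).exists_isMinOn
    (NormedSpace.sphere_nonempty.2 zero_le_one)
    (continuous_seminorm_of_finiteDimensional p).continuousOn
  have hpos : 0 < p x₀ := (apply_nonneg p x₀).lt_of_ne' fun h =>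
    ne_zero_of_mem_unit_sphere ⟨x₀, hx₀⟩ (hp x₀ h)
  refine ⟨(p x₀)⁻¹, fun x => ?_⟩
  rcases eq_or_ne x 0 with rfl | hx
  · simp
  have hx_norm : 0 < ‖x‖ := norm_pos_iff.2 hx
  have hle : p x₀ ≤ p (‖x‖⁻¹ • x) := hmin (by simp [norm_smul, hx_norm.ne'])
  rw [map_smul_eq_mul, norm_inv, norm_norm, le_inv_mul_iff₀ hx_norm] at hle
  rwa [le_inv_mul_iff₀ hpos, mul_comm]

variable {E : Type*} [NormedAddCommGroup E] [InnerProductSpace ℝ E] [FiniteDimensional ℝ E]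
  {p : Seminorm ℝ E}

theorem bddAbove_dualNorm (hp : ∀ x, p x = 0 → x = 0) (ξ : E) :
    BddAbove {r : ℝ | ∃ x : E, p x ≤ 1 ∧ r = inner ℝ ξ x} := by
  obtain ⟨K, hK⟩ := exists_norm_le_mul_seminorm hp
  refine ⟨‖ξ‖ * |K|, ?_⟩
  rintro r ⟨x, hx, rfl⟩
  calc inner ℝ ξ x ≤ ‖ξ‖ * ‖x‖ := real_inner_le_norm ξ x
    _ ≤ ‖ξ‖ * (|K| * 1) := by
        gcongr
        exact (hK x).trans (mul_le_mul (le_abs_self K) hx (apply_nonneg p x) (abs_nonneg K))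
    _ = ‖ξ‖ * |K| := by rw [mul_one]

theorem dualNorm_nonneg (hp : ∀ x, p x = 0 → x = 0) (ξ : E) : 0 ≤ dualNorm p ξ :=
  le_csSup (bddAbove_dualNorm hp ξ) ⟨0, by simp, by simp⟩

theorem inner_le_dualNorm_mul (hp : ∀ x, p x = 0 → x = 0) (ξ x : E) :
    inner ℝ ξ x ≤ dualNorm p ξ * p x := by
  rcases eq_or_ne x 0 with rfl | hx
  · simp
  have hpos : 0 < p x := (apply_nonneg p x).lt_of_ne' fun h => hx (hp x h)
  have hunit : p ((p x)⁻¹ • x) = 1 := by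
    rw [map_smul_eq_mul, norm_inv, Real.norm_of_nonneg hpos.le, inv_mul_cancel₀ hpos.ne']
  have hle : inner ℝ ξ ((p x)⁻¹ • x) ≤ dualNorm p ξ :=
    le_csSup (bddAbove_dualNorm hp ξ) ⟨_, hunit.le, rfl⟩
  rwa [real_inner_smul_right, inv_mul_le_iff₀ hpos, mul_comm] at hle

end DualNorm

section Subdifferential

variable {E : Type*} [NormedAddCommGroup E] [InnerProductSpace ℝ E] {Y : Set E} {ω : E → ℝ}

theorem nonpos_of_forall_mem_Ioo_le_mul {a b : ℝ} (h : ∀ t ∈ Ioo (0 : ℝ) 1, a ≤ t * b) :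
    a ≤ 0 := by
  have hlim : Tendsto (fun t : ℝ => t * b) (𝓝[>] 0) (𝓝 (0 * b)) :=
    (tendsto_id.mono_left nhdsWithin_le_nhds).mul_const b
  rw [zero_mul] at hlim
  exact ge_of_tendsto hlim (eventually_of_mem (Ioo_mem_nhdsGT zero_lt_one) h)

theorem smul_sub_mem_subdiff (hω : ConvexOn ℝ Y ω) {q w : E} {c : ℝ} (hw : w ∈ Y)
    (hmin : ∀ z ∈ Y, ω w + c / 2 * ‖w - q‖ ^ 2 ≤ ω z + c / 2 * ‖z - q‖ ^ 2) :
    c • (q - w) ∈ subdiff Y ω w := by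
  intro z hz
  suffices h : ω w + inner ℝ (c • (q - w)) (z - w) - ω z ≤ 0 from sub_nonpos.1 h
  refine nonpos_of_forall_mem_Ioo_le_mul (b := c / 2 * ‖z - w‖ ^ 2) fun t ⟨ht₀, ht₁⟩ => ?_
  have hle := hmin _ (hω.1.add_smul_sub_mem hw hz ⟨ht₀.le, ht₁.le⟩)
  have hconv : ω (w + t • (z - w)) ≤ (1 - t) * ω w + t * ω z := by
    have h := hω.2 hw hz (sub_nonneg.2 ht₁.le) ht₀.le (sub_add_cancel 1 t)
    rwa [show (1 - t) • w + t • z = w + t • (z - w) by module] at h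
  have hnorm : ‖w + t • (z - w) - q‖ ^ 2
      = ‖w - q‖ ^ 2 - 2 * t * inner ℝ (q - w) (z - w) + t ^ 2 * ‖z - w‖ ^ 2 := by
    rw [show w + t • (z - w) - q = t • (z - w) - (q - w) by module, norm_sub_sq_real, norm_smul,
      real_inner_smul_left, real_inner_comm, norm_sub_rev w q, mul_pow, Real.norm_eq_abs, sq_abs]
    ring
  rw [hnorm] at hle
  rw [real_inner_smul_left]
  refine le_of_mul_le_mul_left ?_ ht₀
  linarith

theorem exists_mem_subdiff_near (hY : IsCompact Y) (hω : ContinuousOn ω Y)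
    (hωc : ConvexOn ℝ Y ω) {q : E} (hq : q ∈ Y) {η : ℝ} (hη : 0 < η) :
    ∃ w ∈ Y, ∃ p ∈ subdiff Y ω w, ‖w - q‖ < η ∧ ‖p‖ * ‖w - q‖ < η := by
  obtain ⟨y₀, -, hmin₀⟩ := hY.exists_isMinOn ⟨q, hq⟩ hω
  obtain ⟨δ, hδ, hcont⟩ := Metric.continuousOn_iff.1 hω q hq (η / 2) (by positivity)
  set r := min δ η
  have hr : 0 < r := lt_min hδ hη
  have hgap : 0 ≤ ω q - ω y₀ := sub_nonneg.2 (hmin₀ hq)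
  obtain ⟨c, hc⟩ := exists_gt (2 * (ω q - ω y₀) / r ^ 2)
  have hc_pos : 0 < c := lt_of_le_of_lt (by positivity) hc
  rw [div_lt_iff₀ (by positivity)] at hc
  obtain ⟨w, hw, hmin⟩ := hY.exists_isMinOn ⟨q, hq⟩
    (hω.add (by fun_prop : ContinuousOn (fun z => c / 2 * ‖z - q‖ ^ 2) Y))
  have hwq : ω w + c / 2 * ‖w - q‖ ^ 2 ≤ ω q := by simpa using hmin hq
  have hnear : ‖w - q‖ < r := by
    have hlow : ω y₀ ≤ ω w := hmin₀ hw
    refine lt_of_pow_lt_pow_left₀ 2 hr.le (lt_of_mul_lt_mul_left ?_ hc_pos.le)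
    linarith
  refine ⟨w, hw, c • (q - w), smul_sub_mem_subdiff hωc hw fun z hz => hmin hz,
    hnear.trans_le (min_le_right _ _), ?_⟩
  have hclose := hcont w hw ((dist_eq_norm w q).trans_lt (hnear.trans_le (min_le_left _ _)))
  rw [Real.dist_eq, abs_lt] at hclose
  rw [norm_smul, Real.norm_of_nonneg hc_pos.le, norm_sub_rev q w]
  linarith

theorem exists_seq_mem_subdiffDomain_tendsto (hY : IsCompact Y) (hω : ContinuousOn ω Y)
    (hωc : ConvexOn ℝ Y ω) {u y : E} (hu : u ∈ Y) (hy : y ∈ Y) :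
    ∃ (c : ℕ → ℝ) (w : ℕ → E), (∀ n, 0 ≤ c n) ∧ (∀ n, w n ∈ subdiffDomain Y ω) ∧
      Tendsto w atTop (𝓝 u) ∧ Tendsto (fun n => c n • (w n - u)) atTop (𝓝 (y - u)) := by
  set t : ℕ → ℝ := fun n => 1 / ((n : ℝ) + 1) with ht
  have ht_pos : ∀ n, 0 < t n := fun n => Nat.one_div_pos_of_nat
  have ht_le : ∀ n, t n ≤ 1 := fun n => by
    rw [ht, div_le_one (by positivity)]; linarith [n.cast_nonneg (α := ℝ)]
  have ht_lim : Tendsto t atTop (𝓝 0) := tendsto_one_div_add_atTop_nhds_zero_nat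
  choose w hwY p hp hw _ using fun n => exists_mem_subdiff_near hY hω hωc
    (hωc.1.add_smul_sub_mem hu hy ⟨(ht_pos n).le, ht_le n⟩) (pow_pos (ht_pos n) 2)
  have hv_lim : Tendsto (fun n => (t n)⁻¹ • (w n - u)) atTop (𝓝 (y - u)) := by
    rw [tendsto_iff_norm_sub_tendsto_zero]
    refine squeeze_zero (fun n => norm_nonneg _) (fun n => ?_) ht_lim
    have heq : (t n)⁻¹ • (w n - u) - (y - u) = (t n)⁻¹ • (w n - (u + t n • (y - u))) := by
      rw [← sub_sub, smul_sub _ (w n - u), inv_smul_smul₀ (ht_pos n).ne']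
    rw [heq, norm_smul, norm_inv, Real.norm_of_nonneg (ht_pos n).le, inv_mul_le_iff₀ (ht_pos n),
      ← pow_two]
    exact (hw n).le
  refine ⟨fun n => (t n)⁻¹, w, fun n => inv_nonneg.2 (ht_pos n).le,
    fun n => ⟨hwY n, p n, hp n⟩, ?_, hv_lim⟩
  have hlim := (ht_lim.smul hv_lim).const_add u
  rw [zero_smul, add_zero] at hlim
  refine hlim.congr fun n => ?_
  rw [smul_inv_smul₀ (ht_pos n).ne', add_sub_cancel]

end Subdifferential

namespace ProximalSetup

variable {E : Type*} [NormedAddCommGroup E] [InnerProductSpace ℝ E] (S : ProximalSetup E)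

theorem inner_ω'_sub_nonneg {u G : E} (hu : u ∈ S.Y) (hG : G ∈ subdiff S.Y S.ω u) {y : E}
    (hy : y ∈ S.Y) : 0 ≤ inner ℝ (S.ω' u - G) (y - u) := by
  obtain ⟨c, w, hc, hw, hw_lim, hcw_lim⟩ := exists_seq_mem_subdiffDomain_tendsto S.isCompact_Y
    S.continuousOn_ω S.convexOn_ω hu hy
  have hω'_lim : Tendsto (fun n => S.ω' (w n)) atTop (𝓝 (S.ω' u)) :=
    (S.continuousOn_ω' u ⟨hu, G, hG⟩).tendsto.comp
      (tendsto_nhdsWithin_iff.2 ⟨hw_lim, Eventually.of_forall hw⟩)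
  refine ge_of_tendsto' ((hω'_lim.sub_const G).inner hcw_lim) fun n => ?_
  have hle_w := hG (w n) (hw n).1
  have hle_u := S.ω'_mem _ (hw n) u hu
  rw [← neg_sub (w n) u, inner_neg_right] at hle_u
  rw [real_inner_smul_right, inner_sub_left]
  exact mul_nonneg (hc n) (by linarith)

theorem sq_nrm_sub_le_inner {w z p q : E} (hw : w ∈ S.Y) (hp : p ∈ subdiff S.Y S.ω w)
    (hz : z ∈ S.Y) (hq : q ∈ subdiff S.Y S.ω z) :
    S.nrm (w - z) ^ 2 ≤ inner ℝ (p - q) (w - z) := by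
  have hωw := S.inner_ω'_sub_nonneg hw hp hz
  have hωz := S.inner_ω'_sub_nonneg hz hq hw
  have hmono := S.strongly_convex w ⟨hw, p, hp⟩ z ⟨hz, q, hq⟩
  rw [← neg_sub w z, inner_neg_right] at hωw
  simp only [inner_sub_left] at *
  linarith

theorem mul_sq_nrm_le_of_mem_subdiff {z q w p d : E} (hz : z ∈ S.Y) (hq : q ∈ subdiff S.Y S.ω z)
    (hw : w ∈ S.Y) (hp : p ∈ subdiff S.Y S.ω w) {s t η : ℝ} (hs : 0 ≤ s) (hst : s ≤ t)
    (htY : z + t • d ∈ S.Y) (hwη : ‖w - (z + s • d)‖ ≤ η) (hpη : ‖p‖ * ‖w - (z + s • d)‖ ≤ η) :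
    (t - s) * S.nrm (w - z) ^ 2 ≤
      s * (S.ω (z + t • d) - S.ω w - inner ℝ q (z + t • d - w)) + t * (η + η * ‖q‖) := by
  have herror : inner ℝ (p - q) (w - (z + s • d)) ≤ η + η * ‖q‖ :=
    calc inner ℝ (p - q) (w - (z + s • d)) ≤ ‖p - q‖ * ‖w - (z + s • d)‖ := real_inner_le_norm _ _
      _ ≤ (‖p‖ + ‖q‖) * ‖w - (z + s • d)‖ := by gcongr; exact norm_sub_le _ _
      _ = ‖p‖ * ‖w - (z + s • d)‖ + ‖w - (z + s • d)‖ * ‖q‖ := by ring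
      _ ≤ η + η * ‖q‖ := by gcongr
  have hsplit : s * inner ℝ (p - q) (z + t • d - w)
      = (t - s) * inner ℝ (p - q) (w - z) - t * inner ℝ (p - q) (w - (z + s • d)) := by
    simp only [← real_inner_smul_right, ← inner_sub_right]
    congr 1
    module
  have hmono := mul_le_mul_of_nonneg_left (S.sq_nrm_sub_le_inner hw hp hz hq) (sub_nonneg.2 hst)
  have hgrow := mul_le_mul_of_nonneg_left (hp _ htY) hs
  have herror' := mul_le_mul_of_nonneg_left herror (hs.trans hst)
  rw [inner_sub_left p q (z + t • d - w)] at hsplit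
  linarith

theorem exists_isArgmin {U : Set E} (hU : IsCompact U) (hne : U.Nonempty) (hUY : U ⊆ S.Y) :
    ∃ y, S.IsArgmin U y :=
  hU.exists_isMinOn hne (S.continuousOn_ω.mono hUY)

theorem zero_mem_subdiff_of_isArgmin {u : E} (hu : S.IsArgmin S.Y u) :
    (0 : E) ∈ subdiff S.Y S.ω u := fun z hz => by
  rw [inner_zero_left, add_zero]
  exact hu.2 z hz

/-- The excess `ω y - min_Y ω`, which measures the progress of the search points in a phase. -/
noncomputable def gap (y : E) : ℝ :=
  S.ω y - sInf (S.ω '' S.Y)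

theorem gap_nonneg {y : E} (hy : y ∈ S.Y) : 0 ≤ S.gap y :=
  sub_nonneg.2 <| csInf_le (S.isCompact_Y.image_of_continuousOn S.continuousOn_ω).bddBelow
    (mem_image_of_mem S.ω hy)

theorem two_mul_gap_le_sq_diam {y : E} (hy : y ∈ S.Y) : 2 * S.gap y ≤ S.diam ^ 2 := by
  have hle_sup : S.ω y ≤ sSup (S.ω '' S.Y) :=
    le_csSup (S.isCompact_Y.image_of_continuousOn S.continuousOn_ω).bddAbove
      (mem_image_of_mem S.ω hy)
  have hgap := S.gap_nonneg hy
  unfold gap at *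
  rw [diam, Real.sq_sqrt (by linarith)]
  linarith

theorem diam_nonneg : 0 ≤ S.diam := Real.sqrt_nonneg _

variable [FiniteDimensional ℝ E]

theorem mul_sq_nrm_le_sub_along_line {z q d : E} (hz : z ∈ S.Y) (hq : q ∈ subdiff S.Y S.ω z)
    {s t : ℝ} (hs : 0 ≤ s) (hst : s ≤ t) (hsY : z + s • d ∈ S.Y) (htY : z + t • d ∈ S.Y) :
    s * (t - s) * S.nrm d ^ 2 ≤
      S.ω (z + t • d) - S.ω (z + s • d) - (t - s) * inner ℝ q d := by
  rcases hs.eq_or_lt with rfl | hs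
  · have hle := hq _ htY
    rw [add_sub_cancel_left, real_inner_smul_right] at hle
    simp only [zero_mul, zero_smul, add_zero, sub_zero]
    linarith
  set η : ℕ → ℝ := fun n => 1 / ((n : ℝ) + 1)
  have hη_lim : Tendsto η atTop (𝓝 0) := tendsto_one_div_add_atTop_nhds_zero_nat
  set y := z + s • d with hy
  choose w hwY p hp hwη hpη using fun n => exists_mem_subdiff_near S.isCompact_Y
    S.continuousOn_ω S.convexOn_ω hsY (Nat.one_div_pos_of_nat (n := n))
  have hw_lim : Tendsto w atTop (𝓝 y) := by
    rw [tendsto_iff_norm_sub_tendsto_zero]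
    exact squeeze_zero (fun n => norm_nonneg _) (fun n => (hwη n).le) hη_lim
  have hω_lim : Tendsto (fun n => S.ω (w n)) atTop (𝓝 (S.ω y)) :=
    (S.continuousOn_ω y hsY).tendsto.comp
      (tendsto_nhdsWithin_iff.2 ⟨hw_lim, Eventually.of_forall hwY⟩)
  have hlhs : Tendsto (fun n => (t - s) * S.nrm (w n - z) ^ 2) atTop
      (𝓝 ((t - s) * S.nrm (y - z) ^ 2)) :=
    ((((continuous_seminorm_of_finiteDimensional S.nrm).tendsto _).comp
      (hw_lim.sub_const z)).pow 2).const_mul _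
  have hrhs := (((hω_lim.const_sub (S.ω (z + t • d))).sub
    (tendsto_const_nhds (x := q) |>.inner (hw_lim.const_sub (z + t • d)))).const_mul s).add
    ((hη_lim.add (hη_lim.mul_const ‖q‖)).const_mul t)
  have hle := le_of_tendsto_of_tendsto' hlhs hrhs fun n =>
    S.mul_sq_nrm_le_of_mem_subdiff hz hq (hwY n) (hp n) hs.le hst htY (hwη n).le (hpη n).le
  rw [show y - z = s • d by rw [hy, add_sub_cancel_left],
    show z + t • d - y = (t - s) • d by rw [hy]; module, map_smul_eq_mul, real_inner_smul_right,
    Real.norm_of_nonneg hs.le] at hle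
  refine le_of_mul_le_mul_left ?_ hs
  linarith

-- The segment from `z` to `x` may miss `Y^o`, so the monotonicity of `ω'` cannot be integrated
-- along it; instead the increments of `ω` over the cells of a uniform grid are added up.
theorem quadratic_growth {z q x : E} (hz : z ∈ S.Y) (hq : q ∈ subdiff S.Y S.ω z) (hx : x ∈ S.Y) :
    S.ω z + inner ℝ q (x - z) + S.nrm (x - z) ^ 2 / 2 ≤ S.ω x := by
  set d := x - z with hd
  set N := S.nrm d ^ 2
  have hgrid : ∀ n k : ℕ, k ≤ n + 1 → (k : ℝ) * (k - 1) / (2 * (n + 1) ^ 2) * N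
      ≤ S.ω (z + ((k : ℝ) / (n + 1)) • d) - S.ω z - (k : ℝ) / (n + 1) * inner ℝ q d := by
    intro n k hk
    have hmem : ∀ i : ℕ, i ≤ n + 1 → z + ((i : ℝ) / (n + 1)) • d ∈ S.Y := fun i hi =>
      S.convex_Y.add_smul_sub_mem hz hx ⟨by positivity, by
        rw [div_le_one (by positivity)]; exact_mod_cast hi⟩
    induction k with
    | zero => simp
    | succ k ih =>
      have hk' : k ≤ n + 1 := k.le_succ.trans hk
      have hstep := S.mul_sq_nrm_le_sub_along_line hz hq (s := k / (n + 1))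
        (t := (k + 1 : ℕ) / (n + 1)) (by positivity) (by gcongr; exact k.le_succ)
        (hmem k hk') (hmem (k + 1) hk)
      have hcoef : ((k + 1 : ℕ) : ℝ) * ((k + 1 : ℕ) - 1) / (2 * (n + 1) ^ 2)
          = k * (k - 1) / (2 * (n + 1) ^ 2)
            + k / (n + 1) * ((k + 1 : ℕ) / (n + 1) - k / (n + 1)) := by
        push_cast
        field_simp
        ring
      rw [hcoef, add_mul]
      linarith [ih hk']
  have hbound : ∀ n : ℕ, (n : ℝ) / (n + 1) * (N / 2) ≤ S.ω x - S.ω z - inner ℝ q d := fun n => by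
    have hle := hgrid n (n + 1) le_rfl
    have hone : (n + 1 : ℝ) ≠ 0 := by positivity
    push_cast at hle
    rw [div_self hone, one_smul, one_mul, hd, add_sub_cancel] at hle
    refine le_of_eq_of_le ?_ hle
    field_simp
    ring
  have hlim := (tendsto_natCast_div_add_atTop (1 : ℝ)).mul_const (N / 2)
  linarith [le_of_tendsto' hlim hbound]

theorem nrm_sub_le_diam {u y : E} (hu : S.IsArgmin S.Y u)
    (hy : y ∈ S.Y) : S.nrm (y - u) ≤ S.diam := by
  have hgrowth := S.quadratic_growth hu.1 (S.zero_mem_subdiff_of_isArgmin hu) hy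
  have hgap_u := S.gap_nonneg hu.1
  have hgap_y := S.two_mul_gap_le_sq_diam hy
  rw [inner_zero_left] at hgrowth
  unfold gap at *
  exact le_of_sq_le_sq (by linarith) S.diam_nonneg

end ProximalSetup

section AffineFunctions

variable {E : Type*} [NormedAddCommGroup E] [InnerProductSpace ℝ E] {t k : ℕ} (P : Protocol E t)

theorem affVal_eq_add_inner (w : Fin t → ℝ) (u y : E) :
    affVal P w y = affVal P w u + inner ℝ (affGrad P w) (y - u) := by
  simp only [affVal, affGrad, inner_neg_left, sum_inner, real_inner_smul_left,
    ← sub_eq_add_neg, ← Finset.sum_sub_distrib, ← mul_sub, ← inner_sub_right, sub_sub,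
    add_sub_cancel]

theorem continuous_affVal (w : Fin t → ℝ) : Continuous (affVal P w) := by
  unfold affVal
  fun_prop

theorem concaveOn_affVal (w : Fin t → ℝ) {Y : Set E} (hY : Convex ℝ Y) :
    ConcaveOn ℝ Y (affVal P w) := by
  refine ⟨hY, fun x _ y _ a b _ _ hab => le_of_eq ?_⟩
  rw [affVal_eq_add_inner P w 0 (a • x + b • y), affVal_eq_add_inner P w 0 x,
    affVal_eq_add_inner P w 0 y]
  simp only [sub_zero, inner_add_right, real_inner_smul_right, smul_eq_mul]
  linear_combination affVal P w 0 * hab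

theorem affVal_comb (c : Fin k → ℝ) (H : Fin k → Fin t → ℝ) (z : E) :
    affVal P (comb c H) z = ∑ j, c j * affVal P (H j) z := by
  simp only [affVal, comb, Finset.sum_mul, Finset.mul_sum, mul_assoc]
  exact Finset.sum_comm

theorem comb_mem_stdSimplex {c : Fin k → ℝ} (hc : c ∈ stdSimplex ℝ (Fin k))
    {H : Fin k → Fin t → ℝ} (hH : ∀ j, H j ∈ stdSimplex ℝ (Fin t)) :
    comb c H ∈ stdSimplex ℝ (Fin t) := by
  refine ⟨fun i => Finset.sum_nonneg fun j _ => mul_nonneg (hc.1 j) ((hH j).1 i), ?_⟩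
  simp only [comb]
  rw [Finset.sum_comm]
  simp only [← Finset.mul_sum, (hH _).2, mul_one, hc.2]

theorem inner_sum_smul_affGrad {H : Fin k → Fin t → ℝ} {μ : Fin k → ℝ} {l : ℝ} {u : E}
    (hμ : ∀ j, μ j * (affVal P (H j) u - l) = 0) (y : E) :
    inner ℝ (∑ j, μ j • affGrad P (H j)) (y - u) = ∑ j, μ j * (affVal P (H j) y - l) := by
  rw [sum_inner]
  refine Finset.sum_congr rfl fun j _ => ?_
  rw [real_inner_smul_left, affVal_eq_add_inner P (H j) u y]
  linear_combination -hμ j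

theorem continuous_iInf_affVal (H : Fin (k + 1) → Fin t → ℝ) :
    Continuous fun z => ⨅ j, affVal P (H j) z := by
  simp only [← Finset.inf'_univ_eq_ciInf]
  exact Continuous.finset_inf'_apply _ fun j _ => continuous_affVal P (H j)

variable {Y : Set E} (hY : IsCompact Y)
include hY

theorem affVal_le_resolution (w : Fin t → ℝ) {z : E} (hz : z ∈ Y) :
    affVal P w z ≤ resolution Y P w :=
  le_csSup (hY.image (continuous_affVal P w)).bddAbove (mem_image_of_mem _ hz)

theorem exists_affVal_le_optVal (H : Fin (k + 1) → Fin t → ℝ) {z : E} (hz : z ∈ Y) :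
    ∃ j, affVal P (H j) z ≤ optVal Y P H := by
  obtain ⟨j, hj⟩ := exists_eq_ciInf_of_finite (f := fun j => affVal P (H j) z)
  exact ⟨j, hj.trans_le
    (le_csSup (hY.image (continuous_iInf_affVal P H)).bddAbove ⟨z, hz, rfl⟩)⟩

variable (hne : Y.Nonempty)
include hne

theorem exists_affVal_eq_resolution (w : Fin t → ℝ) :
    ∃ z ∈ Y, affVal P w z = resolution Y P w :=
  (hY.image (continuous_affVal P w)).sSup_mem (hne.image _)

theorem exists_forall_optVal_le (H : Fin (k + 1) → Fin t → ℝ) :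
    ∃ z ∈ Y, ∀ j, optVal Y P H ≤ affVal P (H j) z := by
  obtain ⟨z, hz, heq⟩ := (hY.image (continuous_iInf_affVal P H)).sSup_mem (hne.image _)
  exact ⟨z, hz, fun j => heq.ge.trans (ciInf_le (Finite.bddBelow_range _) j)⟩

theorem exists_resolution_comb_eq_optVal (hYc : Convex ℝ Y) (H : Fin (k + 1) → Fin t → ℝ) :
    ∃ lam ∈ stdSimplex ℝ (Fin (k + 1)), resolution Y P (comb lam H) = optVal Y P H := by
  obtain ⟨lam, hlam, hnonneg⟩ := exists_mem_stdSimplex_sum_mul_convexOn_nonneg hne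
    (φ := fun j z => optVal Y P H - affVal P (H j) z)
    (fun j => (convexOn_const _ hYc).sub (concaveOn_affVal P (H j) hYc))
    (fun y hy => (exists_affVal_le_optVal P hY H hy).imp fun j => sub_nonneg.2)
  refine ⟨lam, hlam, le_antisymm ?_ ?_⟩
  · obtain ⟨z, hz, hz_eq⟩ := exists_affVal_eq_resolution P hY hne (comb lam H)
    have hle := hnonneg z hz
    simp only [mul_sub, Finset.sum_sub_distrib, ← Finset.sum_mul, hlam.2, one_mul,
      ← affVal_comb] at hle
    linarith
  · obtain ⟨z, hz, hz_ge⟩ := exists_forall_optVal_le P hY hne H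
    calc optVal Y P H = ∑ j, lam j * optVal Y P H := by rw [← Finset.sum_mul, hlam.2, one_mul]
      _ ≤ ∑ j, lam j * affVal P (H j) z :=
        Finset.sum_le_sum fun j _ => mul_le_mul_of_nonneg_left (hz_ge j) (hlam.1 j)
      _ = affVal P (comb lam H) z := (affVal_comb P lam H z).symm
      _ ≤ resolution Y P (comb lam H) := affVal_le_resolution P hY _ hz

end AffineFunctions

section Execution

variable {E : Type*} {g : E → E} {Y : Set E} {m t : ℕ} {σ : State E m t}

/-- `P` records points of `Y` together with the values of the vector field `g` at them. -/
def IsExecution (Y : Set E) (g : E → E) (P : Protocol E t) : Prop :=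
  ∀ i, (P i).1 ∈ Y ∧ (P i).2 = g (P i).1

theorem IsExecution.newP (h : IsExecution Y g σ.P) (hu : σ.u ∈ Y) : IsExecution Y g (σ.newP g) := by
  intro i
  cases i using Fin.lastCases with
  | last => simpa only [State.newP, Fin.snoc_last, and_true] using hu
  | cast i => simpa only [State.newP, Fin.snoc_castSucc] using h i

theorem State.bundle_mem_stdSimplex (h : ∀ j, σ.mem j ∈ stdSimplex ℝ (Fin t)) (j : Fin (m + 1)) :
    σ.bundle j ∈ stdSimplex ℝ (Fin (t + 1)) := by
  cases j using Fin.lastCases with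
  | last => simpa only [bundle, Fin.snoc_last] using single_mem_stdSimplex ℝ (Fin.last t)
  | cast j =>
    simp only [bundle, Fin.snoc_castSucc]
    refine ⟨fun i => ?_, ?_⟩
    · cases i using Fin.lastCases with
      | last => exact (Fin.snoc_last (α := fun _ => ℝ) 0 (σ.mem j)).ge
      | cast i => simpa only [Fin.snoc_castSucc] using (h j).1 i
    · simpa only [Fin.sum_univ_castSucc, Fin.snoc_castSucc, Fin.snoc_last, add_zero] using (h j).2

variable [NormedAddCommGroup E] [InnerProductSpace ℝ E] (σ)

theorem State.affVal_bundle_castSucc (g : E → E) (j : Fin m) (z : E) :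
    affVal (σ.newP g) (σ.bundle j.castSucc) z = affVal σ.P (σ.mem j) z := by
  simp only [affVal, newP, bundle, Fin.sum_univ_castSucc, Fin.snoc_castSucc, Fin.snoc_last,
    zero_mul, add_zero]

theorem State.affVal_bundle_last (g : E → E) (z : E) :
    affVal (σ.newP g) (σ.bundle (Fin.last m)) z = inner ℝ (g σ.u) (σ.u - z) := by
  simp [affVal, newP, bundle, Fin.sum_univ_castSucc]

end Execution

section Steps

variable {E : Type*} [NormedAddCommGroup E] [InnerProductSpace ℝ E] (S : ProximalSetup E)
  (g : E → E) {γ : ℝ} {m t k : ℕ}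

theorem exists_beginsPhase (hγ : γ < 1) (P : Protocol E t) {w : Fin t → ℝ}
    (hw : w ∈ stdSimplex ℝ (Fin t)) (hf : 0 < resolution S.Y P w) :
    ∃ σ : State E m t, BeginsPhase S γ P (resolution S.Y P w) σ := by
  obtain ⟨u, hu⟩ := S.exists_isArgmin S.isCompact_Y S.nonempty_Y subset_rfl
  obtain ⟨z, hz, hz_eq⟩ := exists_affVal_eq_resolution P S.isCompact_Y S.nonempty_Y w
  refine ⟨⟨P, resolution S.Y P w, fun _ => w, u⟩, rfl, rfl, fun _ => hw, ?_, hu⟩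
  refine Set.Nonempty.closure ⟨z, hz, fun _ => ?_⟩
  rw [hz_eq]
  exact mul_lt_of_lt_one_left hf hγ

theorem exists_multipliers_mem_subdiff (P : Protocol E t) (H : Fin (k + 1) → Fin t → ℝ) {l : ℝ}
    (hl : l < optVal S.Y P H) {u : E}
    (hu : S.IsArgmin {y | y ∈ S.Y ∧ ∀ j, l ≤ affVal P (H j) y} u) :
    ∃ μ : Fin (k + 1) → ℝ, (∀ j, 0 ≤ μ j) ∧ (∀ j, μ j * (affVal P (H j) u - l) = 0) ∧
      ∑ j, μ j • affGrad P (H j) ∈ subdiff S.Y S.ω u := by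
  obtain ⟨z, hz, hz_ge⟩ := exists_forall_optVal_le P S.isCompact_Y S.nonempty_Y H
  obtain ⟨μ, hμ_nonneg, hμ_slack, hμ⟩ := exists_lagrange_multipliers S.convexOn_ω
    (φ := fun j y => l - affVal P (H j) y)
    (fun j => (convexOn_const l S.convex_Y).sub (concaveOn_affVal P (H j) S.convex_Y)) hu.1.1
    (fun j => sub_nonpos.2 (hu.1.2 j))
    (fun y hy hfeas => hu.2 y ⟨hy, fun j => sub_nonpos.1 (hfeas j)⟩)
    ⟨z, hz, fun j => sub_neg.2 (hl.trans_le (hz_ge j))⟩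
  simp only [← neg_sub (affVal P _ _) l, mul_neg, neg_eq_zero, Finset.sum_neg_distrib]
    at hμ_slack hμ
  refine ⟨μ, hμ_nonneg, hμ_slack, fun y hy => ?_⟩
  rw [inner_sum_smul_affGrad P hμ_slack]
  linarith [hμ y hy]

theorem exists_continuesPhase (σ : State E m t) (h : γ * σ.f < σ.opt S g) :
    ∃ σ' : State E m (t + 1), ContinuesPhase S g γ σ σ' := by
  obtain ⟨z, hz, hz_ge⟩ :=
    exists_forall_optVal_le (σ.newP g) S.isCompact_Y S.nonempty_Y σ.bundle
  have hclosed : IsClosed {y | ∀ j, γ * σ.f ≤ affVal (σ.newP g) (σ.bundle j) y} := by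
    simp only [ofPred_forall]
    exact isClosed_iInter fun j => isClosed_le continuous_const (continuous_affVal _ _)
  obtain ⟨u, hu⟩ := S.exists_isArgmin (S.isCompact_Y.inter_right hclosed)
    ⟨z, hz, fun j => h.le.trans (hz_ge j)⟩ inter_subset_left
  obtain ⟨μ, hμ_nonneg, hμ_slack, hμ⟩ :=
    exists_multipliers_mem_subdiff S (σ.newP g) σ.bundle h hu
  refine ⟨⟨σ.newP g, σ.f, fun j => if 0 < ∑ j, μ j ∧ j.val = 0
      then comb (fun i => (∑ k, μ k)⁻¹ * μ i) σ.bundle else σ.bundle (Fin.castSuccEmb j), u⟩,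
    rfl, rfl, hu, μ, Fin.castSuccEmb, hμ_nonneg, hμ_slack,
    fun y hy => S.inner_ω'_sub_nonneg hu.1.1 hμ hy, fun hpos j => ?_, fun hzero j => ?_⟩
  · simp only [hpos, true_and]
  · simp only [hzero, lt_irrefl, false_and, if_false]

end Steps

section Counting

variable {γ θ D ε f : ℝ}

/-- The factor `q` in the criterion `Opt < ℓ_s + θ (f_s - ℓ_s) = q f_s` for the end of a phase. -/
noncomputable def phaseRatio (γ θ : ℝ) : ℝ :=
  γ + (1 - γ) * θ

/-- The bound on the number of steps made before the value of the phase drops below `f`; `D` stands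
for `Ω L`. -/
noncomputable def stepBudget (γ θ D f : ℝ) : ℝ :=
  complexityConst γ θ * (D ^ 2 / f ^ 2)

/-- The claimed bound on the number `T` of steps; `D` stands for `Ω L`. -/
def WithinStepBound (γ θ D ε : ℝ) (T : ℕ) : Prop :=
  (ε ≤ D → (T : ℝ) ≤ stepBudget γ θ D ε) ∧ (D < ε → T ≤ 2)

theorem level_add_eq_phaseRatio_mul (γ θ f : ℝ) :
    γ * f + θ * (f - γ * f) = phaseRatio γ θ * f := by
  rw [phaseRatio]
  ring

theorem lt_phaseRatio (hγ : γ < 1) (hθ : 0 < θ) : γ < phaseRatio γ θ :=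
  lt_add_of_pos_right γ (mul_pos (sub_pos.2 hγ) hθ)

theorem phaseRatio_lt_one (hγ : γ < 1) (hθ : θ < 1) : phaseRatio γ θ < 1 := by
  have := mul_lt_of_lt_one_right (sub_pos.2 hγ) hθ
  rw [phaseRatio]
  linarith

theorem sq_phaseRatio_lt_one (hγ : γ ∈ Ioo (0 : ℝ) 1) (hθ : θ ∈ Ioo (0 : ℝ) 1) :
    phaseRatio γ θ ^ 2 < 1 :=
  pow_lt_one₀ (hγ.1.trans (lt_phaseRatio hγ.2 hθ.1)).le (phaseRatio_lt_one hγ.2 hθ.2) two_ne_zero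

theorem complexityConst_nonneg (hq : phaseRatio γ θ ^ 2 < 1) : 0 ≤ complexityConst γ θ :=
  div_nonneg (by positivity) (mul_nonneg (sq_nonneg γ) (sub_pos.2 hq).le)

theorem stepBudget_nonneg (hq : phaseRatio γ θ ^ 2 < 1) (D f : ℝ) : 0 ≤ stepBudget γ θ D f :=
  mul_nonneg (complexityConst_nonneg hq) (by positivity)

theorem stepBudget_le_sq_mul (hq : phaseRatio γ θ ^ 2 < 1) (hf : 0 < f) {a f' : ℝ} (hf' : 0 < f')
    (h : f' ≤ a * f) : stepBudget γ θ D f ≤ a ^ 2 * stepBudget γ θ D f' := by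
  have hsq : f' ^ 2 ≤ a ^ 2 * f ^ 2 := by
    rw [← mul_pow]
    exact pow_le_pow_left₀ hf'.le h 2
  rw [stepBudget, stepBudget, mul_left_comm]
  refine mul_le_mul_of_nonneg_left ?_ (complexityConst_nonneg hq)
  rw [← mul_div_assoc, div_le_div_iff₀ (by positivity) (by positivity)]
  linarith [mul_le_mul_of_nonneg_left hsq (sq_nonneg D)]

theorem stepBudget_anti (hq : phaseRatio γ θ ^ 2 < 1) (hε : 0 < ε) (h : ε ≤ f) :
    stepBudget γ θ D f ≤ stepBudget γ θ D ε := by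
  have hle := stepBudget_le_sq_mul (D := D) (a := 1) hq (hε.trans_le h) hε ((one_mul f).ge.trans' h)
  rwa [one_pow, one_mul] at hle

theorem stepBudget_eq_add (hγ : γ ≠ 0) (hq : phaseRatio γ θ ^ 2 < 1) (D f : ℝ) :
    stepBudget γ θ D f
      = phaseRatio γ θ ^ 2 * stepBudget γ θ D f + D ^ 2 / (γ * f) ^ 2 + D ^ 2 / f ^ 2 := by
  have hq' : 1 - phaseRatio γ θ ^ 2 ≠ 0 := (sub_pos.2 hq).ne'
  have hconst : complexityConst γ θ * (1 - phaseRatio γ θ ^ 2) = 1 / γ ^ 2 + 1 := by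
    rw [complexityConst, ← phaseRatio]
    field_simp
  have hsplit : D ^ 2 / (γ * f) ^ 2 = 1 / γ ^ 2 * (D ^ 2 / f ^ 2) := by
    rw [mul_pow, div_mul_div_comm, one_mul]
  rw [stepBudget, hsplit]
  linear_combination D ^ 2 / f ^ 2 * hconst

theorem one_le_sq_div_sq {a b : ℝ} (ha : 0 < a) (hab : a ≤ b) : 1 ≤ b ^ 2 / a ^ 2 := by
  rw [one_le_div₀ (by positivity)]
  exact pow_le_pow_left₀ ha.le hab 2

theorem one_le_sq_phaseRatio_mul_stepBudget (hγ : 0 < γ) (hγq : γ ≤ phaseRatio γ θ)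
    (hq : phaseRatio γ θ ^ 2 < 1) (hf : 0 < f) (hfD : f ≤ D) :
    1 ≤ phaseRatio γ θ ^ 2 * stepBudget γ θ D f := by
  have hB : 0 ≤ stepBudget γ θ D f := stepBudget_nonneg hq D f
  have hB_ge : D ^ 2 / (γ * f) ^ 2 ≤ stepBudget γ θ D f := by
    rw [stepBudget_eq_add hγ.ne' hq, add_right_comm]
    exact le_add_of_nonneg_left (by positivity)
  calc 1 ≤ D ^ 2 / f ^ 2 := one_le_sq_div_sq hf hfD
    _ = γ ^ 2 * (D ^ 2 / (γ * f) ^ 2) := by field_simp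
    _ ≤ phaseRatio γ θ ^ 2 * stepBudget γ θ D f := by gcongr

theorem two_le_stepBudget (hγ : γ ∈ Ioo (0 : ℝ) 1) (hq : phaseRatio γ θ ^ 2 < 1) (hf : 0 < f)
    (hfD : f ≤ D) : 2 ≤ stepBudget γ θ D f := by
  have hB : 0 ≤ stepBudget γ θ D f := stepBudget_nonneg hq D f
  have hγf : γ * f ≤ D := (mul_le_of_le_one_left hf.le hγ.2.le).trans hfD
  rw [stepBudget_eq_add hγ.1.ne' hq]
  linarith [one_le_sq_div_sq (mul_pos hγ.1 hf) hγf, one_le_sq_div_sq hf hfD,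
    mul_nonneg (sq_nonneg (phaseRatio γ θ)) hB]

theorem withinStepBound_of_le_two (hγ : γ ∈ Ioo (0 : ℝ) 1) (hq : phaseRatio γ θ ^ 2 < 1)
    (hε : 0 < ε) {T : ℕ} (hT : T ≤ 2) : WithinStepBound γ θ D ε T :=
  ⟨fun hD => (Nat.cast_le_ofNat.2 hT).trans (two_le_stepBudget hγ hq hε hD), fun _ => hT⟩

theorem WithinStepBound.mono {T T' : ℕ} (h : WithinStepBound γ θ D ε T') (hT : T ≤ T') :
    WithinStepBound γ θ D ε T :=
  ⟨fun hD => (Nat.cast_le.2 hT).trans (h.1 hD), fun hD => hT.trans (h.2 hD)⟩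

end Counting

section InitialStep

variable {E : Type*} [NormedAddCommGroup E] [InnerProductSpace ℝ E] (S : ProximalSetup E)
  {g : E → E} {L : ℝ}

theorem resolution_le_diam_mul_of_isArgmin [FiniteDimensional ℝ E]
    (hg : ∀ y ∈ S.Y, dualNorm S.nrm (g y) ≤ L) {y : E} (hy : S.IsArgmin S.Y y) :
    resolution S.Y (fun _ : Fin 1 => (y, g y)) (fun _ => 1) ≤ S.diam * L := by
  obtain ⟨z, hz, hz_eq⟩ := exists_affVal_eq_resolution (fun _ : Fin 1 => (y, g y))
    S.isCompact_Y S.nonempty_Y (fun _ => 1)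
  calc resolution S.Y (fun _ : Fin 1 => (y, g y)) (fun _ => 1)
      = inner ℝ (g y) (y - z) := by rw [← hz_eq, affVal, Fin.sum_univ_one, one_mul]
    _ ≤ dualNorm S.nrm (g y) * S.nrm (z - y) := by
      rw [map_sub_rev]
      exact inner_le_dualNorm_mul S.nrm_definite _ _
    _ ≤ L * S.diam := mul_le_mul (hg y hy.1) (S.nrm_sub_le_diam hy hz) (apply_nonneg _ _)
      ((dualNorm_nonneg S.nrm_definite _).trans (hg y hy.1))
    _ = S.diam * L := mul_comm _ _

theorem opt_le_resolution_mem (g : E → E) {m t : ℕ} (σ : State E m t) (j : Fin m) :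
    σ.opt S g ≤ resolution S.Y σ.P (σ.mem j) := by
  obtain ⟨z, hz, hz_ge⟩ :=
    exists_forall_optVal_le (σ.newP g) S.isCompact_Y S.nonempty_Y σ.bundle
  have hle := hz_ge j.castSucc
  rw [σ.affVal_bundle_castSucc] at hle
  exact hle.trans (affVal_le_resolution σ.P S.isCompact_Y _ hz)

end InitialStep

section Invariant

variable {E : Type*} [NormedAddCommGroup E] [InnerProductSpace ℝ E] {S : ProximalSetup E}
  {g : E → E} {L γ θ ε : ℝ} {m t : ℕ}

/-- The part of the invariant of the method that does not count steps: its main content is that the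
current search point minimizes `ω` over the points of `Y` that satisfy the constraints of the
memory. -/
structure State.IsCoherent (S : ProximalSetup E) (g : E → E) (γ : ℝ) (σ : State E m t) :
    Prop where
  isExecution : IsExecution S.Y g σ.P
  mem_stdSimplex : ∀ j, σ.mem j ∈ stdSimplex ℝ (Fin t)
  f_pos : 0 < σ.f
  u_mem : σ.u ∈ S.Y
  exists_subgradient : ∃ G ∈ subdiff S.Y S.ω σ.u, ∀ y ∈ S.Y,
    (∀ j, γ * σ.f ≤ affVal σ.P (σ.mem j) y) → 0 ≤ inner ℝ G (y - σ.u)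

/-- The part of the invariant of the method that counts steps: with `f` the value of the current
phase, `q² B(f)` bounds the steps made before that phase, and the growth of `ω` at the search points
pays for those of the phase itself. -/
structure State.IsOnBudget (S : ProximalSetup E) (L γ θ : ℝ) (σ : State E m t) : Prop where
  f_le : σ.f ≤ S.diam * L
  count : (t : ℝ) ≤ phaseRatio γ θ ^ 2 * stepBudget γ θ (S.diam * L) σ.f
    + 2 * L ^ 2 * S.gap σ.u / (γ * σ.f) ^ 2

variable {σ : State E m t} {σ' : State E m (t + 1)} {P : Protocol E t} {f : ℝ}

theorem BeginsPhase.isCoherent (hσ : BeginsPhase S γ P f σ) (hP : IsExecution S.Y g P)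
    (hf : 0 < f) : σ.IsCoherent S g γ := by
  obtain ⟨rfl, rfl, hmem, -, hu⟩ := hσ
  refine ⟨hP, hmem, hf, hu.1, 0, S.zero_mem_subdiff_of_isArgmin hu, fun y _ _ => ?_⟩
  rw [inner_zero_left]

theorem BeginsPhase.isOnBudget (hσ : BeginsPhase S γ P f σ) (hf : f ≤ S.diam * L)
    (ht : (t : ℝ) ≤ phaseRatio γ θ ^ 2 * stepBudget γ θ (S.diam * L) f) :
    σ.IsOnBudget S L γ θ := by
  obtain ⟨rfl, rfl, -, -, hu⟩ := hσ
  have hgap := S.gap_nonneg hu.1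
  exact ⟨hf, ht.trans (le_add_of_nonneg_right (by positivity))⟩

theorem State.IsCoherent.sq_le_two_mul_gap_sub [FiniteDimensional ℝ E] (h : σ.IsCoherent S g γ)
    (hg : ∀ y ∈ S.Y, dualNorm S.nrm (g y) ≤ L) (hγ : 0 ≤ γ) {u : E} (hu : u ∈ S.Y)
    (hfeas : ∀ j, γ * σ.f ≤ affVal (σ.newP g) (σ.bundle j) u) :
    (γ * σ.f) ^ 2 ≤ 2 * L ^ 2 * (S.gap u - S.gap σ.u) := by
  obtain ⟨G, hG, hsep⟩ := h.exists_subgradient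
  have hgrowth := S.quadratic_growth h.u_mem hG hu
  have hinner := hsep u hu fun j => (hfeas j.castSucc).trans_eq (σ.affVal_bundle_castSucc g j u)
  have hmove : γ * σ.f ≤ L * S.nrm (u - σ.u) :=
    calc γ * σ.f ≤ inner ℝ (g σ.u) (σ.u - u) :=
          (hfeas (Fin.last m)).trans_eq (σ.affVal_bundle_last g u)
      _ ≤ dualNorm S.nrm (g σ.u) * S.nrm (u - σ.u) := by
        rw [map_sub_rev]
        exact inner_le_dualNorm_mul S.nrm_definite _ _
      _ ≤ L * S.nrm (u - σ.u) := by
        gcongr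
        exact hg _ h.u_mem
  calc (γ * σ.f) ^ 2 ≤ (L * S.nrm (u - σ.u)) ^ 2 :=
        pow_le_pow_left₀ (mul_nonneg hγ h.f_pos.le) hmove 2
    _ = L ^ 2 * S.nrm (u - σ.u) ^ 2 := mul_pow _ _ _
    _ ≤ L ^ 2 * (2 * (S.gap u - S.gap σ.u)) := by
      gcongr
      rw [ProximalSetup.gap, ProximalSetup.gap]
      linarith
    _ = 2 * L ^ 2 * (S.gap u - S.gap σ.u) := by ring

theorem ContinuesPhase.mem_stdSimplex (h : ContinuesPhase S g γ σ σ')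
    (hσ : ∀ j, σ.mem j ∈ stdSimplex ℝ (Fin t)) (j : Fin m) :
    σ'.mem j ∈ stdSimplex ℝ (Fin (t + 1)) := by
  obtain ⟨-, -, -, μ, e, hμ, -, -, hmem_pos, hmem_zero⟩ := h
  have hbundle := State.bundle_mem_stdSimplex hσ
  have hsum : 0 ≤ ∑ j, μ j := Finset.sum_nonneg fun j _ => hμ j
  rcases hsum.eq_or_lt with hzero | hpos
  · rw [hmem_zero hzero.symm]
    exact hbundle _
  · rw [hmem_pos hpos]
    split_ifs
    · refine comb_mem_stdSimplex ⟨fun j => mul_nonneg (inv_nonneg.2 hsum) (hμ j), ?_⟩ hbundle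
      rw [← Finset.mul_sum, inv_mul_cancel₀ hpos.ne']
    · exact hbundle _

theorem ContinuesPhase.inner_ω'_nonneg (h : ContinuesPhase S g γ σ σ') (hm : 1 ≤ m) {y : E}
    (hy : y ∈ S.Y) (hfeas : ∀ j, γ * σ'.f ≤ affVal σ'.P (σ'.mem j) y) :
    0 ≤ inner ℝ (S.ω' σ'.u) (y - σ'.u) := by
  obtain ⟨hP, hf, -, μ, e, hμ, hslack, hvar, hmem_pos, -⟩ := h
  have hvar_y := hvar y hy
  rw [inner_sub_left, inner_sum_smul_affGrad _ hslack] at hvar_y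
  refine le_trans ?_ (sub_nonneg.1 hvar_y)
  rcases (Finset.sum_nonneg fun j _ => hμ j : 0 ≤ ∑ j, μ j).eq_or_lt with hzero | hpos
  · have hall := (Finset.sum_eq_zero_iff_of_nonneg fun j _ => hμ j).1 hzero.symm
    exact (Finset.sum_eq_zero fun j hj => by rw [hall j hj, zero_mul]).ge
  · have haggregate := hfeas ⟨0, hm⟩
    rw [hmem_pos hpos, if_pos rfl, hP, hf, affVal_comb] at haggregate
    simp only [mul_assoc, ← Finset.mul_sum] at haggregate
    rw [le_inv_mul_iff₀ hpos, Finset.sum_mul] at haggregate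
    simpa only [mul_sub, Finset.sum_sub_distrib, sub_nonneg] using haggregate

theorem State.IsCoherent.continuesPhase (h : σ.IsCoherent S g γ) (hm : 1 ≤ m)
    (hopt : γ * σ.f < σ.opt S g) (hσ' : ContinuesPhase S g γ σ σ') : σ'.IsCoherent S g γ := by
  have ⟨hP, hf, hu, _⟩ := hσ'
  obtain ⟨μ, -, -, hμ⟩ := exists_multipliers_mem_subdiff S (σ.newP g) σ.bundle hopt hu
  exact
    { isExecution := hP ▸ h.isExecution.newP h.u_mem
      mem_stdSimplex := hσ'.mem_stdSimplex h.mem_stdSimplex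
      f_pos := hf ▸ h.f_pos
      u_mem := hu.1.1
      exists_subgradient :=
        ⟨S.ω' σ'.u, S.ω'_mem _ ⟨hu.1.1, _, hμ⟩, fun _ hy => hσ'.inner_ω'_nonneg hm hy⟩ }

theorem State.IsOnBudget.succ (h : σ.IsOnBudget S L γ θ) (hf : σ'.f = σ.f)
    (hpos : 0 < γ * σ.f) (hgap : (γ * σ.f) ^ 2 ≤ 2 * L ^ 2 * (S.gap σ'.u - S.gap σ.u)) :
    σ'.IsOnBudget S L γ θ := by
  refine ⟨hf.trans_le h.f_le, ?_⟩
  have hone : 1 ≤ 2 * L ^ 2 * (S.gap σ'.u - S.gap σ.u) / (γ * σ.f) ^ 2 := by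
    rwa [one_le_div₀ (by positivity)]
  rw [mul_sub, sub_div] at hone
  rw [hf, Nat.cast_add_one]
  linarith [h.count]

theorem State.IsOnBudget.succ_le_stepBudget (h : σ.IsOnBudget S L γ θ) (hγ : γ ≠ 0)
    (hq : phaseRatio γ θ ^ 2 < 1) (hf : 0 < σ.f) (hu : σ.u ∈ S.Y) :
    ((t + 1 : ℕ) : ℝ) ≤ stepBudget γ θ (S.diam * L) σ.f := by
  have hgap : 2 * L ^ 2 * S.gap σ.u / (γ * σ.f) ^ 2 ≤ (S.diam * L) ^ 2 / (γ * σ.f) ^ 2 := by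
    gcongr
    rw [mul_pow]
    linarith [mul_le_mul_of_nonneg_right (S.two_mul_gap_le_sq_diam hu) (sq_nonneg L)]
  rw [stepBudget_eq_add hγ hq, Nat.cast_add_one]
  linarith [h.count, one_le_sq_div_sq hf h.f_le]

/-- The invariant of the running method. The value `f` of the first phase may be at most `ε`; then
the second step is the last one. -/
structure State.Invariant (S : ProximalSetup E) (g : E → E) (L γ θ ε : ℝ) (σ : State E m t) :
    Prop where
  isCoherent : σ.IsCoherent S g γ
  isOnBudget : σ.IsOnBudget S L γ θ
  of_f_le : σ.f ≤ ε → t = 1 ∧ σ.opt S g ≤ ε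

theorem State.Invariant.withinStepBound (h : σ.Invariant S g L γ θ ε) (hγ : γ ∈ Ioo (0 : ℝ) 1)
    (hq : phaseRatio γ θ ^ 2 < 1) (hε : 0 < ε) :
    WithinStepBound γ θ (S.diam * L) ε (t + 1) := by
  rcases le_or_gt σ.f ε with hf | hf
  · obtain ⟨rfl, -⟩ := h.of_f_le hf
    exact withinStepBound_of_le_two hγ hq hε le_rfl
  · refine ⟨fun _ => ?_, fun hD => absurd (hf.trans_le h.isOnBudget.f_le) hD.not_gt⟩
    exact (h.isOnBudget.succ_le_stepBudget hγ.1.ne' hq h.isCoherent.f_pos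
      h.isCoherent.u_mem).trans (stepBudget_anti hq hε hf.le)

theorem State.Invariant.of_initPhase [FiniteDimensional ℝ E]
    (hg : ∀ y ∈ S.Y, dualNorm S.nrm (g y) ≤ L) (hm : 1 ≤ m) (hγ : γ ∈ Ioo (0 : ℝ) 1)
    (hθ : θ ∈ Ioo (0 : ℝ) 1) {y : E} (hy : S.IsArgmin S.Y y)
    (hf : 0 < resolution S.Y (fun _ : Fin 1 => (y, g y)) (fun _ => 1)) {σ : State E m 1}
    (hσ : BeginsPhase S γ (fun _ => (y, g y))
      (resolution S.Y (fun _ : Fin 1 => (y, g y)) (fun _ => 1)) σ) :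
    σ.Invariant S g L γ θ ε where
  isCoherent := hσ.isCoherent (fun _ => ⟨hy.1, rfl⟩) hf
  isOnBudget := by
    have hfD := resolution_le_diam_mul_of_isArgmin S hg hy
    refine hσ.isOnBudget hfD ?_
    rw [Nat.cast_one]
    exact one_le_sq_phaseRatio_mul_stepBudget hγ.1 (lt_phaseRatio hγ.2 hθ.1).le
      (sq_phaseRatio_lt_one hγ hθ) hf hfD
  of_f_le hfε := by
    obtain ⟨hP, hf_eq, hmem, -⟩ := hσ
    have hmem_eq : σ.mem ⟨0, hm⟩ = fun _ => 1 :=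
      mem_singleton_iff.1 ((stdSimplex_unique ℝ (Fin 1)).subset (hmem ⟨0, hm⟩))
    have hopt := opt_le_resolution_mem S g σ ⟨0, hm⟩
    rw [hmem_eq, hP, ← hf_eq] at hopt
    exact ⟨rfl, hopt.trans hfε⟩

theorem State.Invariant.newPhase (h : σ.Invariant S g L γ θ ε) (hγ : γ ∈ Ioo (0 : ℝ) 1)
    (hθ : θ ∈ Ioo (0 : ℝ) 1) (hε : 0 < ε) (hA : ε < σ.opt S g)
    (hB : σ.opt S g < γ * σ.f + θ * (σ.f - γ * σ.f))
    (hσ' : BeginsPhase S γ (σ.newP g) (σ.opt S g) σ') : σ'.Invariant S g L γ θ ε := by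
  have ⟨_, hf', _⟩ := hσ'
  have hq := sq_phaseRatio_lt_one hγ hθ
  have hf := h.isCoherent.f_pos
  have hopt : 0 < σ.opt S g := hε.trans hA
  rw [level_add_eq_phaseRatio_mul] at hB
  have hoptD : σ.opt S g ≤ S.diam * L :=
    (hB.le.trans (mul_le_of_le_one_left hf.le (phaseRatio_lt_one hγ.2 hθ.2).le)).trans
      h.isOnBudget.f_le
  have hcount := (h.isOnBudget.succ_le_stepBudget hγ.1.ne' hq hf h.isCoherent.u_mem).trans
    (stepBudget_le_sq_mul hq hf hopt hB.le)
  exact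
    { isCoherent := hσ'.isCoherent (h.isCoherent.isExecution.newP h.isCoherent.u_mem) hopt
      isOnBudget := hσ'.isOnBudget hoptD hcount
      of_f_le := fun hle => absurd (hf'.ge.trans hle) hA.not_ge }

theorem State.IsCoherent.level_lt_opt (h : σ.IsCoherent S g γ) (hγ : γ < 1) (hθ : 0 < θ)
    (hC : γ * σ.f + θ * (σ.f - γ * σ.f) ≤ σ.opt S g) : γ * σ.f < σ.opt S g :=
  (lt_add_of_pos_right _ (mul_pos hθ (sub_pos.2 (mul_lt_of_lt_one_left h.f_pos hγ)))).trans_le hC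

theorem State.Invariant.continuesPhase [FiniteDimensional ℝ E] (h : σ.Invariant S g L γ θ ε)
    (hg : ∀ y ∈ S.Y, dualNorm S.nrm (g y) ≤ L) (hm : 1 ≤ m) (hγ : 0 < γ) (hA : ε < σ.opt S g)
    (hopt : γ * σ.f < σ.opt S g) (hσ' : ContinuesPhase S g γ σ σ') :
    σ'.Invariant S g L γ θ ε := by
  have ⟨_, hf, ⟨⟨hu, hfeas⟩, _⟩, _⟩ := hσ'
  have hgap := h.isCoherent.sq_le_two_mul_gap_sub hg hγ.le hu hfeas
  exact
    { isCoherent := h.isCoherent.continuesPhase hm hopt hσ'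
      isOnBudget := h.isOnBudget.succ hf (mul_pos hγ h.isCoherent.f_pos) hgap
      of_f_le := fun hle => absurd (h.of_f_le (hf.ge.trans hle)).2 hA.not_ge }

theorem State.IsCoherent.exists_step (h : σ.IsCoherent S g γ) (hγ : γ < 1) (hθ : 0 < θ)
    (hε : 0 < ε) : ∃ c', Step S g γ θ ε (.running t σ) c' := by
  obtain ⟨lam, hlam, hopt⟩ := exists_resolution_comb_eq_optVal (σ.newP g) S.isCompact_Y
    S.nonempty_Y S.convex_Y σ.bundle
  rcases le_or_gt (σ.opt S g) ε with hA | hA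
  · exact ⟨_, .terminate t σ hA lam ⟨hlam, hopt⟩⟩
  rcases lt_or_ge (σ.opt S g) (γ * σ.f + θ * (σ.f - γ * σ.f)) with hB | hC
  · obtain ⟨σ', hσ'⟩ := exists_beginsPhase S (m := m) hγ (σ.newP g)
      (comb_mem_stdSimplex hlam (State.bundle_mem_stdSimplex h.mem_stdSimplex))
      ((hε.trans hA).trans_eq hopt.symm)
    exact ⟨_, .newPhase t σ hA hB lam ⟨hlam, hopt⟩ σ' hσ'⟩
  · obtain ⟨σ', hσ'⟩ := exists_continuesPhase S g σ (h.level_lt_opt hγ hθ hC)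
    exact ⟨_, .samePhase t σ hA hC σ' hσ'⟩

theorem exists_step_start (S : ProximalSetup E) (g : E → E) (m : ℕ) (θ ε : ℝ) (hγ : γ < 1) :
    ∃ c' : Config E m, Step S g γ θ ε .start c' := by
  obtain ⟨y, hy⟩ := S.exists_isArgmin S.isCompact_Y S.nonempty_Y subset_rfl
  have hnonneg : 0 ≤ resolution S.Y (fun _ : Fin 1 => (y, g y)) (fun _ => 1) := by
    refine le_of_eq_of_le ?_ (affVal_le_resolution _ S.isCompact_Y _ hy.1)
    simp only [affVal, sub_self, inner_zero_right, mul_zero, Finset.sum_const_zero]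
  rcases hnonneg.eq_or_lt with hf | hf
  · exact ⟨_, .initStop y hy hf.symm⟩
  · obtain ⟨σ, hσ⟩ := exists_beginsPhase S (m := m) hγ _ ((stdSimplex_unique ℝ (Fin 1)).ge rfl) hf
    exact ⟨_, .initPhase y hy hf σ hσ⟩

end Invariant

section Runs

variable {E : Type*} {m : ℕ}

/-- The number of evaluations of `g` recorded in a configuration. -/
def Config.oracleCalls : Config E m → ℕ
  | .start => 0
  | .running t _ => t
  | .done t _ _ => t

variable [NormedAddCommGroup E] [InnerProductSpace ℝ E] {S : ProximalSetup E} {g : E → E}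
  {L γ θ ε : ℝ} {T : ℕ} {c c' : Config E m}

theorem ReachedIn.oracleCalls_eq (h : ReachedIn S g γ θ ε T c) : c.oracleCalls = T := by
  induction h with
  | zero => rfl
  | succ _ _ _ _ hstep ih => subst ih; cases hstep <;> rfl

/-- The invariant of the method, which after termination says that the output is as claimed. -/
def Config.Invariant (S : ProximalSetup E) (g : E → E) (L γ θ ε : ℝ) : Config E m → Prop
  | .start => True
  | .running _ σ => σ.Invariant S g L γ θ ε
  | .done t P lam => IsExecution S.Y g P ∧ lam ∈ stdSimplex ℝ (Fin t) ∧
      resolution S.Y P lam ≤ ε ∧ WithinStepBound γ θ (S.diam * L) ε t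

theorem Config.Invariant.done_or_exists_step (hc : c.Invariant S g L γ θ ε) (hγ : γ < 1)
    (hθ : 0 < θ) (hε : 0 < ε) :
    (∃ (t : ℕ) (P : Protocol E t) (lam : Fin t → ℝ), c = .done t P lam) ∨
      ∃ c', Step S g γ θ ε c c' := by
  cases c with
  | start => exact .inr (exists_step_start S g m θ ε hγ)
  | running t σ => exact .inr (State.Invariant.isCoherent hc |>.exists_step hγ hθ hε)
  | done t P lam => exact .inl ⟨t, P, lam, rfl⟩

theorem Config.Invariant.withinStepBound (hc : c.Invariant S g L γ θ ε) (hγ : γ ∈ Ioo (0 : ℝ) 1)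
    (hθ : θ ∈ Ioo (0 : ℝ) 1) (hε : 0 < ε) :
    WithinStepBound γ θ (S.diam * L) ε c.oracleCalls := by
  have hq := sq_phaseRatio_lt_one hγ hθ
  cases c with
  | start => exact withinStepBound_of_le_two hγ hq hε zero_le_two
  | running t σ => exact (State.Invariant.withinStepBound hc hγ hq hε).mono t.le_succ
  | done t P lam => exact hc.2.2.2

variable [FiniteDimensional ℝ E] (hg : ∀ y ∈ S.Y, dualNorm S.nrm (g y) ≤ L) (hm : 1 ≤ m)
  (hγ : γ ∈ Ioo (0 : ℝ) 1) (hθ : θ ∈ Ioo (0 : ℝ) 1) (hε : 0 < ε)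
include hg hm hγ hθ hε

theorem Config.Invariant.step (hc : c.Invariant S g L γ θ ε) (hstep : Step S g γ θ ε c c') :
    c'.Invariant S g L γ θ ε := by
  have hq := sq_phaseRatio_lt_one hγ hθ
  cases hstep with
  | initStop y hy hf =>
    exact ⟨fun _ => ⟨hy.1, rfl⟩, ((stdSimplex_unique ℝ (Fin 1)).ge rfl), hf.trans_le hε.le,
      withinStepBound_of_le_two hγ hq hε one_le_two⟩
  | initPhase y hy hf σ hσ => exact .of_initPhase hg hm hγ hθ hy hf hσ
  | terminate t σ hA lam hlam =>
    have hcoh := State.Invariant.isCoherent hc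
    exact ⟨hcoh.isExecution.newP hcoh.u_mem,
      comb_mem_stdSimplex hlam.1 (State.bundle_mem_stdSimplex hcoh.mem_stdSimplex),
      hlam.2.trans_le hA, State.Invariant.withinStepBound hc hγ hq hε⟩
  | newPhase t σ hA hB lam hlam σ' hσ' =>
    exact State.Invariant.newPhase hc hγ hθ hε hA hB (hlam.2 ▸ hσ')
  | samePhase t σ hA hC σ' hσ' =>
    have hcoh := State.Invariant.isCoherent hc
    exact State.Invariant.continuesPhase hc hg hm hγ.1 hA (hcoh.level_lt_opt hγ.2 hθ.1 hC) hσ'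

theorem ReachedIn.invariant (h : ReachedIn S g γ θ ε T c) : c.Invariant S g L γ θ ε := by
  induction h with
  | zero => trivial
  | succ _ _ _ _ hstep ih => exact ih.step hg hm hγ hθ hε hstep

end Runs

end NERML

theorem proposition6 {E : Type*} [NormedAddCommGroup E] [InnerProductSpace ℝ E]
    [FiniteDimensional ℝ E] (S : NERML.ProximalSetup E) (g : E → E) (L : ℝ)
    (hg : ∀ y ∈ S.Y, NERML.dualNorm S.nrm (g y) ≤ L)
    (m : ℕ) (hm : 1 ≤ m) (γ θ : ℝ) (hγ : γ ∈ Set.Ioo (0 : ℝ) 1) (hθ : θ ∈ Set.Ioo (0 : ℝ) 1)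
    (ε : ℝ) (hε : 0 < ε) :
    -- the method never gets stuck: as long as it has not terminated, its next step can be made
    (∀ (T : ℕ) (c : NERML.Config E m), NERML.ReachedIn S g γ θ ε T c →
      (∃ (t : ℕ) (P : NERML.Protocol E t) (lam : Fin t → ℝ), c = NERML.Config.done t P lam) ∨
      ∃ c' : NERML.Config E m, NERML.Step S g γ θ ε c c') ∧
    -- whatever choices are made, the number of steps is bounded
    (∀ (T : ℕ) (c : NERML.Config E m), NERML.ReachedIn S g γ θ ε T c →
      (ε ≤ S.diam * L →
        (T : ℝ) ≤ NERML.complexityConst γ θ * (S.diam ^ 2 * L ^ 2 / ε ^ 2)) ∧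
      (S.diam * L < ε → T ≤ 2)) ∧
    -- upon termination after `T` steps, the output is an execution protocol of length `T` with an
    -- accuracy certificate of resolution at most `ε`
    (∀ (T t : ℕ) (P : NERML.Protocol E t) (lam : Fin t → ℝ),
      NERML.ReachedIn S g γ θ ε T (NERML.Config.done t P lam : NERML.Config E m) →
      t = T ∧ (∀ i, (P i).1 ∈ S.Y ∧ (P i).2 = g (P i).1) ∧
      (∀ i, 0 ≤ lam i) ∧ ∑ i, lam i = 1 ∧ NERML.resolution S.Y P lam ≤ ε) := by
  refine ⟨fun T c hc => (hc.invariant hg hm hγ hθ hε).done_or_exists_step hγ.2 hθ.1 hε,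
    fun T c hc => ?_, fun T t P lam hc => ?_⟩
  · have hbound := (hc.invariant hg hm hγ hθ hε).withinStepBound hγ hθ hε
    rwa [hc.oracleCalls_eq, NERML.WithinStepBound, NERML.stepBudget, mul_pow] at hbound
  · obtain ⟨hP, hlam, hres, -⟩ := hc.invariant hg hm hγ hθ hε
    exact ⟨hc.oracleCalls_eq, hP, hlam.1, hlam.2, hres⟩
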